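/- **Setting.** Alice has actions $A=\{1,\dots,m\}$, Bob has actions $B=\{1,\dots,n\}$ ($m,n,K\ge 1$), $\beta\in[0,1)$, and the vector losses satisfy $\mathbf r(a,b)\in[0,1-\beta]^K$. In the infinitely repeated game, behavioural strategies $\pi_A,\pi_B$ map each finite history of action pairs to mixed actions (the two players randomize independently in each stage), and $R_k(\pi_A,\pi_B)=\mathrm E\big[\sum_{t\ge1}\beta^{t-1}r_k(a_t,b_t)\big]$. A strategy $\pi_A$ has guarantee vector $\big(\max_{\pi_B}R_k(\pi_A,\pi_B)\big)_{k}$. Let $\mathcal W^\infty$ be the set of all guarantee vectors. For a set $\mathcal S$ let $\Lambda(\mathcal S)$ be the set of elements of $\mathcal S$ that are componentwise $\ge$ no other element of $\mathcal S$, and let $\mathcal V^\infty=\Lambda(\mathcal W^\infty)$. Let $\mathcal F$ be the family of non-empty sets $\mathcal V\subseteq[0,1]^K$ in which no two distinct elements are componentwise comparable and whose upset $\{\mathbf x\in[0,1]^K:\mathbf x\succeq\mathbf v\text{ for some }\mathbf v\in\mathcal V\}$ is closed and convex. For $\mathcal V\in\mathcal F$ let $\Phi(\mathcal V)=\Lambda(\Psi(\mathcal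 V))$, where $\Psi(\mathcal V)$ is the set of all vectors $\big(\max_{b}\sum_a\alpha_a[r_k(a,b)+\beta R_k(a,b)]\big)_k$ with $\boldsymbol\alpha\in\Delta(A)$ and $\mathbf R(a,b)\in\mathcal V$ for all $a,b$. Let $\mathcal P=\{\mathbf p\in[0,1]^K:\ p_k=0\text{ for some }k\}$, and for $\mathbf p\in\mathcal P$ let $\mathbf F(\mathbf p,\mathcal V)=t\mathbf 1+\mathbf p$ with the smallest $t\in\mathbb R$ such that $t\mathbf 1+\mathbf p\succeq\mathbf u$ for some $\mathbf u\in\mathcal V$. **Theorem.** The set $\mathcal P$ is compact; $\Phi$ has exactly one fixed point $\mathcal V^*$ in $\mathcal F$; and $\mathcal V^*=\mathcal V^\infty$. The minimum defining $\mathbf F(\mathbf p,\mathcal V^*)$ exists for every $\mathbf p\in\mathcal P$, and every $\mathbf u\in\mathcal V^*$ equals $\mathbf F(\mathbf p,\mathcal V^*)$ for exactly one $\mathbf p\in\mathcal P$. There are maps $\boldsymbol\alpha:\mathcal P\to\Delta(A)$ and $\mathbf q:B\times\mathcal P\to\mathcal P$ with $\mathbf F(\mathbf q(b,\mathbf p),\mathcal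 V^*)\in\mathcal V^*$ for all $b,\mathbf p$ and $$\max_{b\in B}\Big\{\sum_{a\in A}\alpha_a(\mathbf p)r_k(a,b)+\beta F_k(\mathbf q(b,\mathbf p),\mathcal V^*)\Big\}\le F_k(\mathbf p,\mathcal V^*)\qquad\text{for all }\mathbf p\in\mathcal P,\ k. \tag{1}$$ For all maps $\boldsymbol\alpha,\mathbf q$ that satisfy (1) and every $\mathbf p_1\in\mathcal P$, let $\sigma_{\mathbf p_1}$ be the stationary strategy that starts in state $\mathbf p_1$, plays $\boldsymbol\alpha(\mathbf p)$ whenever the current state is $\mathbf p$, and then moves to $\mathbf q(b,\mathbf p)$ when Bob has played $b$. Then: 1. $R_k(\sigma_{\mathbf p_1},\pi_B)\le F_k(\mathbf p_1,\mathcal V^*)$ for all $k$ and all strategies $\pi_B$ of Bob. 2. After every finite history $h$, leading to the state $\mathbf p_h$, the continuation of $\sigma_{\mathbf p_1}$ has expected discounted loss (discounted from that stage on) at most $F_k(\mathbf p_h,\mathcal V^*)$ in each component $k$, against every strategy of Bob. 3. If $\mathbf F(\mathbf p_1,\mathcal V^*)\in\mathcal V^*$, then (1) holds with equality at $\mathbf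 p=\mathbf p_1$, and the guarantee vector of $\sigma_{\mathbf p_1}$ is exactly $\mathbf F(\mathbf p_1,\mathcal V^*)$. 4. $\sigma_{\mathbf p_1}$ does not depend on Alice's own past actions. In particular, every point of $\mathcal V^\infty$ is attained by a strategy of Alice that ignores her own past actions and is stationary on the compact state space $\mathcal P$. -/

import Mathlib

open MeasureTheory ProbabilityTheory

namespace VectorGame

/-! Vectors of `ℝ^K` are functions `Fin K → ℝ` with the componentwise order; `Set.Icc 0 1` is the
cube `[0,1]^K`. Alice's actions are `Fin m`, Bob's are `Fin n`, and `stdSimplex ℝ (Fin m)` is the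
set of mixed actions of Alice. A history is the list, in chronological order, of the pairs
(Alice's action, Bob's action) played so far. -/

/-! ### The infinitely repeated discounted game -/

/-- A behavioural strategy of a player with `l` actions: a mixed action after every history. -/
abbrev Strategy (m n l : ℕ) : Type := List (Fin m × Fin n) → stdSimplex ℝ (Fin l)

/-- The probability measure on `Fin l` given by a mixed action. -/
noncomputable def mixedLaw {l : ℕ} (α : stdSimplex ℝ (Fin l)) : Measure (Fin l) :=
  ∑ a, ENNReal.ofReal (α a) • Measure.dirac a

instance mixedLaw_isProbabilityMeasure {l : ℕ} (α : stdSimplex ℝ (Fin l)) :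
    IsProbabilityMeasure (mixedLaw α) := by
  constructor
  have h1 : ∑ a, ENNReal.ofReal (α a) = 1 := by
    rw [← ENNReal.ofReal_sum_of_nonneg (fun a _ => show 0 ≤ α a from α.2.1 a), show ∑ a, α a = 1 from α.2.2, ENNReal.ofReal_one]
  simp [mixedLaw, h1]

/-- The law of the pair of actions played after the history `h`: the players randomize
independently of each other. -/
noncomputable def stageLaw {m n : ℕ} (πA : Strategy m n m) (πB : Strategy m n n)
    (h : List (Fin m × Fin n)) : Measure (Fin m × Fin n) :=
  (mixedLaw (πA h)).prod (mixedLaw (πB h))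

instance stageLaw_isProbabilityMeasure {m n : ℕ} (πA : Strategy m n m) (πB : Strategy m n n)
    (h : List (Fin m × Fin n)) : IsProbabilityMeasure (stageLaw πA πB h) := by
  unfold stageLaw; infer_instance

/-- The list of the first `t + 1` action pairs of a play. -/
def historyOf {m n : ℕ} (t : ℕ) (x : (i : Finset.Iic t) → Fin m × Fin n) :
    List (Fin m × Fin n) :=
  List.ofFn fun i : Fin (t + 1) => x ⟨i, Finset.mem_Iic.2 (Nat.lt_succ_iff.1 i.2)⟩

/-- The conditional law of the action pair at time `t + 1` given those at times `0, …, t`. -/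
noncomputable def stageKernel {m n : ℕ} (πA : Strategy m n m) (πB : Strategy m n n) (t : ℕ) :
    Kernel ((i : Finset.Iic t) → Fin m × Fin n) (Fin m × Fin n) where
  toFun x := stageLaw πA πB (historyOf t x)
  measurable' := measurable_of_countable _

instance stageKernel_isMarkovKernel {m n : ℕ} (πA : Strategy m n m) (πB : Strategy m n n)
    (t : ℕ) : IsMarkovKernel (stageKernel πA πB t) :=
  ⟨fun x => stageLaw_isProbabilityMeasure πA πB (historyOf t x)⟩

/-- The law of the infinite play `(a₀, b₀), (a₁, b₁), …` induced by a pair of strategies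
(Ionescu-Tulcea). -/
noncomputable def playLaw {m n : ℕ} (πA : Strategy m n m) (πB : Strategy m n n) :
    Measure (ℕ → Fin m × Fin n) :=
  Kernel.trajMeasure (X := fun _ => Fin m × Fin n) (stageLaw πA πB []) (stageKernel πA πB)

/-- The expected total discounted loss of Alice on component `k` (stages counted from `0`). -/
noncomputable def expectedLoss {m n K : ℕ} (β : ℝ) (r : Fin m → Fin n → Fin K → ℝ)
    (πA : Strategy m n m) (πB : Strategy m n n) (k : Fin K) : ℝ :=
  ∫ x, ∑' t : ℕ, β ^ t * r (x t).1 (x t).2 k ∂(playLaw πA πB)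

/-- `w` is the vector of simultaneous upper bounds that `πA` guarantees: in each component, the
maximum over the strategies of Bob of the expected loss. -/
def IsGuarantee {m n K : ℕ} (β : ℝ) (r : Fin m → Fin n → Fin K → ℝ)
    (πA : Strategy m n m) (w : Fin K → ℝ) : Prop :=
  ∀ k, IsGreatest (Set.range fun πB : Strategy m n n => expectedLoss β r πA πB k) (w k)

/-- The lower Pareto frontier of a set: its elements that dominate no other element of it. -/
def lowerFrontier {K : ℕ} (S : Set (Fin K → ℝ)) : Set (Fin K → ℝ) :=
  {x ∈ S | ∀ y ∈ S, y ≤ x → y = x}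

/-- The minimal vectors of simultaneous upper bounds that Alice can guarantee in the infinitely
repeated game. -/
def optimalFrontier {m n K : ℕ} (β : ℝ) (r : Fin m → Fin n → Fin K → ℝ) : Set (Fin K → ℝ) :=
  lowerFrontier {w | ∃ πA : Strategy m n m, IsGuarantee β r πA w}

/-- The strategy that `π` prescribes from the history `h` on. -/
def continuation {m n l : ℕ} (π : Strategy m n l) (h : List (Fin m × Fin n)) :
    Strategy m n l := fun h' => π (h ++ h')

/-! ### Pareto frontiers and the dynamic programming operator -/

/-- The upset in `[0,1]^K`. -/
def upset {K : ℕ} (S : Set (Fin K → ℝ)) : Set (Fin K → ℝ) :=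
  {x ∈ Set.Icc 0 1 | ∃ y ∈ S, y ≤ x}

/-- The space of (non-empty) Pareto frontiers in `[0,1]^K` whose upset is closed and convex. -/
def frontierSpace (K : ℕ) : Set (Set (Fin K → ℝ)) :=
  {V | V.Nonempty ∧ V ⊆ Set.Icc 0 1 ∧ (∀ u ∈ V, ∀ v ∈ V, u ≤ v → u = v) ∧
    IsClosed (upset V) ∧ Convex ℝ (upset V)}

/-- The vectors of upper bounds obtained from a mixed action `α` and continuation bounds
`R a b ∈ S` that may depend on both actions. -/
def dpSet {m n K : ℕ} [NeZero n] (β : ℝ) (r : Fin m → Fin n → Fin K → ℝ)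
    (S : Set (Fin K → ℝ)) : Set (Fin K → ℝ) :=
  {u | ∃ (α : stdSimplex ℝ (Fin m)) (R : Fin m → Fin n → Fin K → ℝ), (∀ a b, R a b ∈ S) ∧
    ∀ k, u k = Finset.univ.sup' Finset.univ_nonempty
      fun b : Fin n => ∑ a, α a * (r a b k + β * R a b k)}

/-- The dynamic programming operator. -/
def dpOperator {m n K : ℕ} [NeZero n] (β : ℝ) (r : Fin m → Fin n → Fin K → ℝ)
    (V : Set (Fin K → ℝ)) : Set (Fin K → ℝ) :=
  lowerFrontier (dpSet β r V)

/-! ### Parametrization of frontiers and stationary strategies -/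

/-- The parameter set: the faces of `[0,1]^K` on which some coordinate is `0`. -/
def paramSet (K : ℕ) : Set (Fin K → ℝ) :=
  {p | (∀ k, p k ∈ Set.Icc 0 1) ∧ ∃ k, p k = 0}

/-- The `t` for which `t • 1 + p` dominates an element of `V`. -/
def feasibleShifts {K : ℕ} (p : Fin K → ℝ) (V : Set (Fin K → ℝ)) : Set ℝ :=
  {t | ∃ u ∈ V, ∀ k, u k ≤ t + p k}

/-- The smallest point of the line `t • 1 + p` that dominates an element of `V`. -/
noncomputable def paramPoint {K : ℕ} (p : Fin K → ℝ) (V : Set (Fin K → ℝ)) : Fin K → ℝ :=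
  fun k => sInf (feasibleShifts p V) + p k

/-- The bound on component `k` that results from playing the mixed action `α p` in the state `p`
and continuing with the bound of the state `q b p` when Bob plays `b`. -/
noncomputable def stateBound {m n K : ℕ} [NeZero n] (β : ℝ) (r : Fin m → Fin n → Fin K → ℝ)
    (V : Set (Fin K → ℝ)) (α : paramSet K → stdSimplex ℝ (Fin m))
    (q : Fin n → paramSet K → paramSet K) (p : paramSet K) (k : Fin K) : ℝ :=
  Finset.univ.sup' Finset.univ_nonempty fun b : Fin n =>
    ∑ a, α p a * r a b k + β * paramPoint (q b p : Fin K → ℝ) V k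

/-- The state reached from `p` after a history: each action `b` of Bob moves `p` to `q b p`. -/
def stateAfter {m n K : ℕ} (q : Fin n → paramSet K → paramSet K) (p : paramSet K)
    (h : List (Fin m × Fin n)) : paramSet K :=
  h.foldl (fun s c => q c.2 s) p

/-- The stationary strategy with initial state `p`: play the mixed action of the current state. -/
def stationary {m n K : ℕ} (α : paramSet K → stdSimplex ℝ (Fin m))
    (q : Fin n → paramSet K → paramSet K) (p : paramSet K) : Strategy m n m :=
  fun h => α (stateAfter q p h)

end VectorGame

open VectorGame

/-! A frontier in `frontierSpace` is determined by its upset, on which the dynamic programming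
operator becomes the monotone map `dpUpset β r` (`lowerFrontier_dpSet`). Call a set `U`
self-supporting if `U ⊆ dpUpset β r U`. By Knaster-Tarski the union `greatestUpset` of all
self-supporting sets is fixed, and it inherits convexity and closedness because `dpUpset` preserves
them. Discounting makes any non-empty closed fixed set equal to it (`eq_greatestUpset`), so the
lower frontier of `greatestUpset` is the only fixed point.

The game enters from two sides. Lower bound: the guarantee vectors form a self-supporting set,
because Bob can play any `b` and then reply optimally in each continuation; hence each of them
dominates a point of the fixed point `V` (`isGuarantee_mem_greatestUpset`). Upper bound: a point of
`V` splits into a mixed action and continuation bounds; convexity allows these bounds to be averaged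
over Alice's action, so the next state depends on Bob's action only (`exists_stationary_data`).
Iterating the one-stage inequality bounds the loss of the stationary strategy
(`expectedLoss_stationary_le`). Since no two points of `V` are comparable, the two bounds meet on
`V` (`stationary_exact`). -/

namespace VectorGame

variable {m n K : ℕ}

/-! ### Expected losses as discounted sums -/

/-- The probability that the pair `c` is played after the history `h`. -/
noncomputable def stageWeight (πA : Strategy m n m) (πB : Strategy m n n)
    (h : List (Fin m × Fin n)) (c : Fin m × Fin n) : ℝ :=
  πA h c.1 * πB h c.2

lemma mixedLaw_real_singleton {l : ℕ} (α : stdSimplex ℝ (Fin l)) (a : Fin l) :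
    (mixedLaw α).real {a} = α a := by
  have h : ∀ x : Fin l, (if x = a then ENNReal.ofReal (α x) else 0) =
      if x = a then ENNReal.ofReal (α a) else 0 := by
    intro x; split_ifs with h <;> simp [h]
  have h0 : 0 ≤ α a := α.2.1 a
  simp [mixedLaw, Measure.real, Set.indicator_apply, h0]

lemma integral_stageLaw (πA : Strategy m n m) (πB : Strategy m n n)
    (h : List (Fin m × Fin n)) (f : Fin m × Fin n → ℝ) :
    ∫ c, f c ∂(stageLaw πA πB h) = ∑ c, stageWeight πA πB h c * f c := by
  rw [integral_fintype Integrable.of_finite]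
  refine Finset.sum_congr rfl fun c _ => ?_
  obtain ⟨a, b⟩ := c
  rw [stageLaw, ← Set.singleton_prod_singleton, measureReal_prod_prod, mixedLaw_real_singleton,
    mixedLaw_real_singleton, smul_eq_mul, stageWeight]

lemma stageWeight_nonneg (πA : Strategy m n m) (πB : Strategy m n n)
    (h : List (Fin m × Fin n)) (c : Fin m × Fin n) : 0 ≤ stageWeight πA πB h c :=
  mul_nonneg ((πA h).2.1 _) ((πB h).2.1 _)

lemma sum_stageWeight (πA : Strategy m n m) (πB : Strategy m n n)
    (h : List (Fin m × Fin n)) : ∑ c, stageWeight πA πB h c = 1 := by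
  have := integral_stageLaw πA πB h (fun _ => 1)
  simpa using this.symm

instance playLaw_isProbabilityMeasure (πA : Strategy m n m) (πB : Strategy m n n) :
    IsProbabilityMeasure (playLaw πA πB) := by
  unfold playLaw; infer_instance

/-- The list of the first `t` action pairs of an infinite play. -/
def initialHistory (t : ℕ) (x : ℕ → Fin m × Fin n) : List (Fin m × Fin n) :=
  List.ofFn fun i : Fin t => x i

lemma map_eval_zero_playLaw (πA : Strategy m n m) (πB : Strategy m n n) :
    (playLaw πA πB).map (fun x => x 0) = stageLaw πA πB [] := by
  have hf : (fun x : ℕ → Fin m × Fin n => x 0) =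
      (fun y : (i : Finset.Iic 0) → Fin m × Fin n => y ⟨0, by simp⟩) ∘
        Preorder.frestrictLe (π := fun _ => Fin m × Fin n) 0 := rfl
  rw [hf, ← Measure.map_map (by fun_prop) (by fun_prop), playLaw, Kernel.trajMeasure,
    Measure.map_comp _ _ (by fun_prop), Kernel.traj_map_frestrictLe, Kernel.partialTraj_self,
    Measure.id_comp, Measure.map_map (by fun_prop) (by fun_prop)]
  exact Measure.map_id

/-- Tower property: the joint law of a prefix and the next action pair is the prefix law composed
with the stage kernel. Stage `0` is separate because it is drawn from the initial law. -/
lemma integral_initialHistory_succ (πA : Strategy m n m) (πB : Strategy m n n) (t : ℕ)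
    (g : List (Fin m × Fin n) → Fin m × Fin n → ℝ) :
    ∫ x, g (initialHistory t x) (x t) ∂(playLaw πA πB) =
      ∫ x, ∑ c, stageWeight πA πB (initialHistory t x) c * g (initialHistory t x) c
        ∂(playLaw πA πB) := by
  cases t with
  | zero =>
    have h0 : ∀ x : ℕ → Fin m × Fin n, initialHistory 0 x = [] := fun x => rfl
    simp only [h0]
    rw [integral_const, ← integral_stageLaw, ← map_eval_zero_playLaw πA πB,
      integral_map (measurable_pi_apply 0).aemeasurable
        (by exact (Measurable.of_discrete).aestronglyMeasurable)]
    simp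
  | succ t =>
    let G : ((i : Finset.Iic t) → Fin m × Fin n) × (Fin m × Fin n) → ℝ :=
      fun y => g (historyOf t y.1) y.2
    have h1 := Kernel.map_frestrictLe_trajMeasure_compProd_eq_map_trajMeasure
      (X := fun _ => Fin m × Fin n) (μ₀ := stageLaw πA πB []) (κ := stageKernel πA πB) (a := t)
    have h2 : ∫ x, g (initialHistory (t + 1) x) (x (t + 1)) ∂(playLaw πA πB) =
        ∫ y, G y ∂((playLaw πA πB).map
          (fun x => (Preorder.frestrictLe (π := fun _ => Fin m × Fin n) t x, x (t + 1)))) := by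
      rw [integral_map (by fun_prop) (by exact (Measurable.of_discrete).aestronglyMeasurable)]
      rfl
    rw [h2]
    unfold playLaw
    rw [← h1, Measure.integral_compProd Integrable.of_finite,
      integral_map (by fun_prop) (by exact (Measurable.of_discrete).aestronglyMeasurable)]
    refine integral_congr_ae (Filter.Eventually.of_forall fun x => ?_)
    exact integral_stageLaw _ _ _ _

/-- The expected value of `f` at the action pair of stage `t`. -/
noncomputable def stageMean (f : Fin m × Fin n → ℝ) :
    ℕ → Strategy m n m → Strategy m n n → ℝ
  | 0, πA, πB => ∑ c, stageWeight πA πB [] c * f c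
  | t + 1, πA, πB => ∑ c, stageWeight πA πB [] c *
      stageMean f t (continuation πA [c]) (continuation πB [c])

/-- The expected value of `g` at the history of the first `t` stages. -/
noncomputable def historyMean :
    ℕ → (List (Fin m × Fin n) → ℝ) → Strategy m n m → Strategy m n n → ℝ
  | 0, g, _, _ => g []
  | t + 1, g, πA, πB => ∑ c, stageWeight πA πB [] c *
      historyMean t (fun l => g (c :: l)) (continuation πA [c]) (continuation πB [c])

/-- The recursion for `historyMean` splits off the first stage, while conditioning in `playLaw`
splits off the last; this lemma reconciles the two. -/
lemma historyMean_succ (t : ℕ) : ∀ (g : List (Fin m × Fin n) → ℝ) (πA : Strategy m n m)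
    (πB : Strategy m n n), historyMean (t + 1) g πA πB =
      historyMean t (fun l => ∑ c, stageWeight πA πB l c * g (l ++ [c])) πA πB := by
  induction t with
  | zero => intro g πA πB; rfl
  | succ t ih =>
    intro g πA πB
    rw [historyMean]
    conv_rhs => rw [historyMean]
    exact Finset.sum_congr rfl fun c _ => congrArg _ (ih _ _ _)

lemma historyMean_stageWeight (f : Fin m × Fin n → ℝ) (t : ℕ) :
    ∀ (πA : Strategy m n m) (πB : Strategy m n n),
      historyMean t (fun l => ∑ c, stageWeight πA πB l c * f c) πA πB = stageMean f t πA πB := by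
  induction t with
  | zero => intro πA πB; rfl
  | succ t ih =>
    intro πA πB
    rw [stageMean]
    simp_rw [← ih]
    rfl

lemma integral_initialHistory (πA : Strategy m n m) (πB : Strategy m n n) (t : ℕ) :
    ∀ g : List (Fin m × Fin n) → ℝ,
      ∫ x, g (initialHistory t x) ∂(playLaw πA πB) = historyMean t g πA πB := by
  induction t with
  | zero =>
    intro g
    have h0 : ∀ x : ℕ → Fin m × Fin n, initialHistory 0 x = [] := fun x => rfl
    simp [h0, historyMean]
  | succ t ih =>
    intro g
    have h0 : ∀ x : ℕ → Fin m × Fin n,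
        initialHistory (t + 1) x = initialHistory t x ++ [x t] := fun x => by
      rw [initialHistory, List.ofFn_succ_last]; rfl
    simp_rw [h0]
    rw [integral_initialHistory_succ πA πB t (fun l c => g (l ++ [c])), historyMean_succ, ← ih]

lemma integral_eval_playLaw (πA : Strategy m n m) (πB : Strategy m n n) (t : ℕ)
    (f : Fin m × Fin n → ℝ) :
    ∫ x, f (x t) ∂(playLaw πA πB) = stageMean f t πA πB := by
  rw [integral_initialHistory_succ πA πB t (fun _ c => f c),
    integral_initialHistory πA πB t (fun l => ∑ c, stageWeight πA πB l c * f c),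
    historyMean_stageWeight]

lemma stageMean_mem_Icc {f : Fin m × Fin n → ℝ} {C : ℝ} (hf : ∀ c, f c ∈ Set.Icc 0 C)
    (t : ℕ) : ∀ (πA : Strategy m n m) (πB : Strategy m n n),
      stageMean f t πA πB ∈ Set.Icc 0 C := by
  have key : ∀ (πA : Strategy m n m) (πB : Strategy m n n) (g : Fin m × Fin n → ℝ),
      (∀ c, g c ∈ Set.Icc 0 C) → ∑ c, stageWeight πA πB [] c * g c ∈ Set.Icc 0 C :=
    fun πA πB g hg => (convex_Icc (0 : ℝ) C).sum_mem
      (fun c _ => stageWeight_nonneg πA πB [] c) (sum_stageWeight πA πB []) (fun c _ => hg c)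
  induction t with
  | zero => intro πA πB; exact key _ _ _ hf
  | succ t ih => intro πA πB; exact key _ _ _ fun c => ih _ _

/-- Continuity is in the product topology: only the finitely many histories of length at most `t`
matter. -/
lemma continuous_stageMean (f : Fin m × Fin n → ℝ) (πA : Strategy m n m) (t : ℕ) :
    Continuous fun πB : Strategy m n n => stageMean f t πA πB := by
  have hw : ∀ (πA : Strategy m n m) c,
      Continuous fun πB : Strategy m n n => stageWeight πA πB [] c := fun πA c => by
    have : Continuous fun πB : Strategy m n n => (πB [] : Fin n → ℝ) c.2 :=
      (continuous_apply c.2).comp (continuous_subtype_val.comp (continuous_apply []))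
    exact continuous_const.mul this
  induction t generalizing πA with
  | zero => exact continuous_finsetSum _ fun c _ => (hw _ c).mul continuous_const
  | succ t ih =>
    refine continuous_finsetSum _ fun c _ => (hw _ c).mul ((ih _).comp ?_)
    exact continuous_pi fun l => continuous_apply _

/-! ### Discounted totals: recursion, bounds and attained maxima. -/

variable {β : ℝ} {r : Fin m → Fin n → Fin K → ℝ}

lemma norm_discount_mul_le (hβ : β ∈ Set.Ico (0 : ℝ) 1) {y : ℝ} (hy : y ∈ Set.Icc 0 (1 - β))
    (t : ℕ) : ‖β ^ t * y‖ ≤ β ^ t * (1 - β) := by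
  rw [Real.norm_of_nonneg (mul_nonneg (pow_nonneg hβ.1 _) hy.1)]
  exact mul_le_mul_of_nonneg_left hy.2 (pow_nonneg hβ.1 _)

lemma hasSum_discount (hβ : β ∈ Set.Ico (0 : ℝ) 1) :
    HasSum (fun t : ℕ => β ^ t * (1 - β)) 1 := by
  have := (hasSum_geometric_of_lt_one hβ.1 hβ.2).mul_right (1 - β)
  rwa [inv_mul_cancel₀ (by linarith [hβ.2])] at this

theorem hasSum_expectedLoss (hβ : β ∈ Set.Ico (0 : ℝ) 1)
    (hr : ∀ a b k, r a b k ∈ Set.Icc 0 (1 - β)) (πA : Strategy m n m) (πB : Strategy m n n)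
    (k : Fin K) :
    HasSum (fun t : ℕ => β ^ t * stageMean (fun c => r c.1 c.2 k) t πA πB)
      (expectedLoss β r πA πB k) := by
  have hmeas : ∀ t : ℕ, Measurable fun x : ℕ → Fin m × Fin n => β ^ t * r (x t).1 (x t).2 k :=
    fun t => measurable_const.mul
      ((Measurable.of_discrete (f := fun c : Fin m × Fin n => r c.1 c.2 k)).comp
        (measurable_pi_apply t))
  have h := hasSum_integral_of_dominated_convergence (μ := playLaw πA πB)
    (F := fun t x => β ^ t * r (x t).1 (x t).2 k)
    (f := fun x => ∑' t : ℕ, β ^ t * r (x t).1 (x t).2 k)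
    (fun t _ => β ^ t * (1 - β)) (fun t => (hmeas t).aestronglyMeasurable)
    (fun t => Filter.Eventually.of_forall fun x => norm_discount_mul_le hβ (hr _ _ _) t)
    (Filter.Eventually.of_forall fun _ => (hasSum_discount hβ).summable)
    (integrable_const _)
    (Filter.Eventually.of_forall fun x => (Summable.of_norm_bounded
      (hasSum_discount hβ).summable fun t => norm_discount_mul_le hβ (hr _ _ _) t).hasSum)
  simp_rw [integral_const_mul] at h
  have h2 := fun t => integral_eval_playLaw πA πB t (fun c => r c.1 c.2 k)
  simp_rw [h2] at h
  exact h

/-- Conditioning on the first stage. -/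
theorem expectedLoss_eq (hβ : β ∈ Set.Ico (0 : ℝ) 1)
    (hr : ∀ a b k, r a b k ∈ Set.Icc 0 (1 - β)) (πA : Strategy m n m) (πB : Strategy m n n)
    (k : Fin K) :
    expectedLoss β r πA πB k = ∑ c, stageWeight πA πB [] c *
      (r c.1 c.2 k + β * expectedLoss β r (continuation πA [c]) (continuation πB [c]) k) := by
  have h := hasSum_expectedLoss hβ hr πA πB k
  refine h.unique ?_
  -- Without stage `0`, the series is the weighted sum of the continuation series, each multiplied
  -- by one factor `β`.
  rw [← hasSum_nat_add_iff' 1]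
  have h2 := hasSum_sum (s := Finset.univ) fun c (_ : c ∈ Finset.univ) =>
    (hasSum_expectedLoss hβ hr (continuation πA [c]) (continuation πB [c]) k).mul_left
      (stageWeight πA πB [] c * β)
  convert! h2 using 1
  · funext t
    rw [stageMean, Finset.mul_sum]
    exact Finset.sum_congr rfl fun c _ => by ring
  · rw [Finset.sum_range_one, pow_zero, one_mul, stageMean, ← Finset.sum_sub_distrib]
    exact Finset.sum_congr rfl fun c _ => by ring

theorem expectedLoss_mem_Icc (hβ : β ∈ Set.Ico (0 : ℝ) 1)
    (hr : ∀ a b k, r a b k ∈ Set.Icc 0 (1 - β)) (πA : Strategy m n m) (πB : Strategy m n n)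
    (k : Fin K) : expectedLoss β r πA πB k ∈ Set.Icc 0 1 := by
  have h := hasSum_expectedLoss hβ hr πA πB k
  have hm := fun t => stageMean_mem_Icc (f := fun c => r c.1 c.2 k) (fun c => hr c.1 c.2 k)
    t πA πB
  exact ⟨h.nonneg fun t => mul_nonneg (pow_nonneg hβ.1 _) (hm t).1,
    hasSum_le (fun t => mul_le_mul_of_nonneg_left (hm t).2 (pow_nonneg hβ.1 _)) h
      (hasSum_discount hβ)⟩

theorem continuous_expectedLoss (hβ : β ∈ Set.Ico (0 : ℝ) 1)
    (hr : ∀ a b k, r a b k ∈ Set.Icc 0 (1 - β)) (πA : Strategy m n m) (k : Fin K) :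
    Continuous fun πB : Strategy m n n => expectedLoss β r πA πB k := by
  simp_rw [← fun πB => (hasSum_expectedLoss hβ hr πA πB k).tsum_eq]
  exact continuous_tsum (fun t => continuous_const.mul (continuous_stageMean _ πA t))
    (hasSum_discount hβ).summable fun t πB =>
      norm_discount_mul_le hβ (stageMean_mem_Icc (fun c => hr c.1 c.2 k) t πA πB) t

/-- Bob's strategy space is a product of simplices, hence compact, and the loss is continuous on it.
The maximizer may differ from one component to another. -/
theorem exists_isGuarantee [NeZero n] (hβ : β ∈ Set.Ico (0 : ℝ) 1)
    (hr : ∀ a b k, r a b k ∈ Set.Icc 0 (1 - β)) (πA : Strategy m n m) :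
    ∃ w, IsGuarantee β r πA w := by
  have : Nonempty (Strategy m n n) := ⟨fun _ => stdSimplex.vertex 0⟩
  have h := fun k => (isCompact_range (continuous_expectedLoss hβ hr πA k)).exists_isGreatest
    (Set.range_nonempty _)
  choose w hw using h
  exact ⟨w, hw⟩

/-! ### Lower frontiers -/

lemma lowerFrontier_eq_of_subset {A B : Set (Fin K → ℝ)} (hAB : A ⊆ B)
    (h : ∀ b ∈ B, ∃ a ∈ A, a ≤ b) : lowerFrontier A = lowerFrontier B := by
  ext x
  constructor
  · rintro ⟨hx, hmin⟩
    refine ⟨hAB hx, fun y hy hyx => ?_⟩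
    obtain ⟨a, ha, hay⟩ := h y hy
    have := hmin a ha (hay.trans hyx)
    exact le_antisymm hyx (this ▸ hay)
  · rintro ⟨hx, hmin⟩
    obtain ⟨a, ha, hax⟩ := h x hx
    have hax' := hmin a (hAB ha) hax
    exact ⟨hax' ▸ ha, fun y hy hyx => hmin y (hAB hy) hyx⟩

/-- A minimizer of the coordinate sum over the part of `C` below `x` is minimal in `C`: a point of
`C` below it has the same sum, hence the same coordinates. -/
lemma exists_mem_lowerFrontier_le {C : Set (Fin K → ℝ)} (hC : IsCompact C) {x : Fin K → ℝ}
    (hx : x ∈ C) : ∃ y ∈ lowerFrontier C, y ≤ x := by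
  have hcomp : IsCompact (C ∩ Set.Iic x) := hC.inter_right isClosed_Iic
  obtain ⟨y, ⟨hyC, hyx⟩, hmin⟩ := hcomp.exists_isMinOn ⟨x, hx, le_refl x⟩
    (f := fun z : Fin K → ℝ => ∑ k, z k) (by fun_prop)
  refine ⟨y, ⟨hyC, fun z hz hzy => ?_⟩, hyx⟩
  have h1 : ∑ k, y k ≤ ∑ k, z k := hmin ⟨hz, hzy.trans hyx⟩
  have h2 : ∑ k, z k = ∑ k, y k := le_antisymm (Finset.sum_le_sum fun k _ => hzy k) h1
  funext k
  exact (Finset.sum_eq_sum_iff_of_le fun k _ => hzy k).1 h2 k (Finset.mem_univ k)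

lemma isCompact_of_subset_cube {U : Set (Fin K → ℝ)} (hU : U ⊆ Set.Icc 0 1)
    (hc : IsClosed U) : IsCompact U :=
  isCompact_Icc.of_isClosed_subset hc hU

lemma upset_subset (V : Set (Fin K → ℝ)) : upset V ⊆ Set.Icc 0 1 := fun _ hx => hx.1

lemma subset_upset {V : Set (Fin K → ℝ)} (hV : V ⊆ Set.Icc 0 1) : V ⊆ upset V :=
  fun x hx => ⟨hV hx, x, hx, le_refl x⟩

lemma upset_lowerFrontier {U : Set (Fin K → ℝ)} (hU : U ⊆ Set.Icc 0 1) (hc : IsClosed U)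
    (hup : ∀ x ∈ U, ∀ y ∈ Set.Icc (0 : Fin K → ℝ) 1, x ≤ y → y ∈ U) :
    upset (lowerFrontier U) = U := by
  ext x
  constructor
  · rintro ⟨hx, y, hy, hyx⟩
    exact hup y hy.1 x hx hyx
  · intro hx
    obtain ⟨y, hy, hyx⟩ := exists_mem_lowerFrontier_le (isCompact_of_subset_cube hU hc) hx
    exact ⟨hU hx, y, hy, hyx⟩

lemma lowerFrontier_mem_frontierSpace {U : Set (Fin K → ℝ)} (hne : U.Nonempty)
    (hU : U ⊆ Set.Icc 0 1) (hc : IsClosed U) (hconv : Convex ℝ U)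
    (hup : ∀ x ∈ U, ∀ y ∈ Set.Icc (0 : Fin K → ℝ) 1, x ≤ y → y ∈ U) :
    lowerFrontier U ∈ frontierSpace K := by
  refine ⟨?_, fun x hx => hU hx.1, fun u hu v hv huv => hv.2 u hu.1 huv, ?_, ?_⟩
  · obtain ⟨x, hx⟩ := hne
    obtain ⟨y, hy, -⟩ := exists_mem_lowerFrontier_le (isCompact_of_subset_cube hU hc) hx
    exact ⟨y, hy⟩
  · rwa [upset_lowerFrontier hU hc hup]
  · rwa [upset_lowerFrontier hU hc hup]

/-! ### The dynamic programming operator on upsets -/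

/-- The vectors of `[0,1]^K` that dominate a vector of one-stage bounds with continuation bounds
in `S`. -/
def dpUpset (β : ℝ) (r : Fin m → Fin n → Fin K → ℝ) (S : Set (Fin K → ℝ)) :
    Set (Fin K → ℝ) :=
  {x ∈ Set.Icc 0 1 | ∃ (α : stdSimplex ℝ (Fin m)) (R : Fin m → Fin n → Fin K → ℝ),
    (∀ a b, R a b ∈ S) ∧ ∀ b k, ∑ a, α a * (r a b k + β * R a b k) ≤ x k}

lemma dpUpset_mono {S T : Set (Fin K → ℝ)} (h : S ⊆ T) : dpUpset β r S ⊆ dpUpset β r T := by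
  rintro x ⟨hx, α, R, hR, hle⟩
  exact ⟨hx, α, R, fun a b => h (hR a b), hle⟩

lemma dpUpset_upward (S : Set (Fin K → ℝ)) : ∀ x ∈ dpUpset β r S,
    ∀ y ∈ Set.Icc (0 : Fin K → ℝ) 1, x ≤ y → y ∈ dpUpset β r S := by
  rintro x ⟨hx, α, R, hR, hle⟩ y hy hxy
  exact ⟨hy, α, R, hR, fun b k => (hle b k).trans (hxy k)⟩

/-- Alice tosses a coin between the two plans and forgets the outcome. The new continuation bound is
the conditional mean of `R a b` and `R' a b` given her action `a`, so it matters here that bounds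
may depend on `a`. -/
lemma convex_dpUpset {S : Set (Fin K → ℝ)} (hS : Convex ℝ S) : Convex ℝ (dpUpset β r S) := by
  rintro x ⟨hx, α, R, hR, hle⟩ y ⟨hy, α', R', hR', hle'⟩ s t hs ht hst
  refine ⟨convex_Icc _ _ hx hy hs ht hst,
    ⟨s • (α : Fin m → ℝ) + t • (α' : Fin m → ℝ),
      convex_stdSimplex ℝ (Fin m) α.2 α'.2 hs ht hst⟩, ?_⟩
  have h0 : ∀ a, 0 ≤ s * α a := fun a => mul_nonneg hs (α.2.1 a)
  have h0' : ∀ a, 0 ≤ t * α' a := fun a => mul_nonneg ht (α'.2.1 a)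
  have key : ∀ a b, ∃ z ∈ S, ∀ k,
      (s * α a + t * α' a) * z k = s * α a * R a b k + t * α' a * R' a b k := by
    intro a b
    rcases (add_nonneg (h0 a) (h0' a)).eq_or_lt with h | h
    -- An action of probability zero has no conditional mean; any element of `S` will do.
    · have h1 : s * α a = 0 := by linarith [h0 a, h0' a]
      have h2 : t * α' a = 0 := by linarith [h0 a, h0' a]
      exact ⟨R a b, hR a b, fun k => by rw [h1, h2]; ring⟩
    · refine ⟨_, hS (hR a b) (hR' a b) (div_nonneg (h0 a) h.le) (div_nonneg (h0' a) h.le)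
        (by rw [← add_div, div_self h.ne']), fun k => ?_⟩
      simp only [Pi.add_apply, Pi.smul_apply, smul_eq_mul]
      field_simp
  choose Z hZ hZeq using key
  refine ⟨Z, hZ, fun b k => ?_⟩
  calc ∑ a, (s * α a + t * α' a) * (r a b k + β * Z a b k)
      = s * ∑ a, α a * (r a b k + β * R a b k) + t * ∑ a, α' a * (r a b k + β * R' a b k) := by
        rw [Finset.mul_sum, Finset.mul_sum, ← Finset.sum_add_distrib]
        refine Finset.sum_congr rfl fun a _ => ?_
        linear_combination β * hZeq a b k
    _ ≤ s * x k + t * y k :=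
        add_le_add (mul_le_mul_of_nonneg_left (hle b k) hs)
          (mul_le_mul_of_nonneg_left (hle' b k) ht)

/-- It is the projection of a compact set of triples (bound, mixed action, continuation bounds). -/
lemma isClosed_dpUpset {S : Set (Fin K → ℝ)} (hS : IsCompact S) :
    IsClosed (dpUpset β r S) := by
  let P : Set (Fin m → Fin n → Fin K → ℝ) :=
    Set.univ.pi fun _ => Set.univ.pi fun _ => S
  have hP : IsCompact P := isCompact_univ_pi fun _ => isCompact_univ_pi fun _ => hS
  let G : Set ((Fin K → ℝ) × stdSimplex ℝ (Fin m) × (Fin m → Fin n → Fin K → ℝ)) :=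
    {z | ∀ b k, ∑ a, (z.2.1 : Fin m → ℝ) a * (r a b k + β * z.2.2 a b k) ≤ z.1 k}
  have hG : IsClosed G := by
    simp only [G, Set.ofPred_forall]
    refine isClosed_iInter fun b => isClosed_iInter fun k => isClosed_le ?_ (by fun_prop)
    refine continuous_finsetSum _ fun a _ => Continuous.mul ?_ (by fun_prop)
    exact (continuous_apply a).comp
      (continuous_subtype_val.comp (continuous_fst.comp continuous_snd))
  have hcomp : IsCompact ((Set.Icc (0 : Fin K → ℝ) 1 ×ˢ
      ((Set.univ : Set (stdSimplex ℝ (Fin m))) ×ˢ P)) ∩ G) :=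
    (isCompact_Icc.prod (isCompact_univ.prod hP)).inter_right hG
  have himg : dpUpset β r S = Prod.fst '' ((Set.Icc (0 : Fin K → ℝ) 1 ×ˢ
      ((Set.univ : Set (stdSimplex ℝ (Fin m))) ×ˢ P)) ∩ G) := by
    ext x
    constructor
    · rintro ⟨hx, α, R, hR, hle⟩
      exact ⟨(x, α, R), ⟨⟨hx, trivial, fun a _ b _ => hR a b⟩, hle⟩, rfl⟩
    · rintro ⟨⟨x, α, R⟩, ⟨⟨hx, -, hR⟩, hle⟩, rfl⟩
      exact ⟨hx, α, R, fun a b => hR a trivial b trivial, hle⟩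
  rw [himg]
  exact (hcomp.image continuous_fst).isClosed

lemma stageBound_mem_Icc (hβ : β ∈ Set.Ico (0 : ℝ) 1)
    (hr : ∀ a b k, r a b k ∈ Set.Icc 0 (1 - β)) (α : stdSimplex ℝ (Fin m))
    {R : Fin m → Fin n → Fin K → ℝ} (hR : ∀ a b, R a b ∈ Set.Icc (0 : Fin K → ℝ) 1)
    (b : Fin n) (k : Fin K) : ∑ a, α a * (r a b k + β * R a b k) ∈ Set.Icc (0 : ℝ) 1 := by
  refine (convex_Icc (0 : ℝ) 1).sum_mem (fun a _ => α.2.1 a) α.2.2 fun a _ => ?_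
  have h0 : 0 ≤ R a b k := (hR a b).1 k
  have h1 : R a b k ≤ 1 := (hR a b).2 k
  exact ⟨add_nonneg (hr a b k).1 (mul_nonneg hβ.1 h0),
    by nlinarith [(hr a b k).2, hβ.1]⟩

/-- Lowering every continuation bound from `upset V` to a point of `V` beneath it only lowers the
result, so the larger set has no new minimal points. -/
lemma lowerFrontier_dpSet [NeZero n] (hβ : β ∈ Set.Ico (0 : ℝ) 1)
    (hr : ∀ a b k, r a b k ∈ Set.Icc 0 (1 - β)) {V : Set (Fin K → ℝ)}
    (hV : V ⊆ Set.Icc 0 1) :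
    lowerFrontier (dpSet β r V) = lowerFrontier (dpUpset β r (upset V)) := by
  apply lowerFrontier_eq_of_subset
  · rintro u ⟨α, R, hR, hu⟩
    have hmem := stageBound_mem_Icc hβ hr α fun a b => hV (hR a b)
    refine ⟨⟨fun k => ?_, fun k => ?_⟩, α, R, fun a b => subset_upset hV (hR a b),
      fun b k => ?_⟩
    · rw [hu k]
      exact (hmem 0 k).1.trans (Finset.le_sup'
        (fun b : Fin n => ∑ a, α a * (r a b k + β * R a b k)) (Finset.mem_univ 0))
    · rw [hu k]
      exact Finset.sup'_le _ _ fun b _ => (hmem b k).2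
    · rw [hu k]
      exact Finset.le_sup' (fun b : Fin n => ∑ a, α a * (r a b k + β * R a b k))
        (Finset.mem_univ b)
  · rintro x ⟨hx, α, R, hR, hle⟩
    have h := fun a b => (hR a b).2
    choose Q hQ hQR using h
    refine ⟨_, ⟨α, Q, hQ, fun k => rfl⟩, fun k => Finset.sup'_le _ _ fun b _ => ?_⟩
    refine le_trans (Finset.sum_le_sum fun a _ => ?_) (hle b k)
    have := mul_le_mul_of_nonneg_left (hQR a b k) hβ.1
    exact mul_le_mul_of_nonneg_left (by linarith) (α.2.1 a)

lemma dpUpset_upset_of_fixed [NeZero n] (hβ : β ∈ Set.Ico (0 : ℝ) 1)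
    (hr : ∀ a b k, r a b k ∈ Set.Icc 0 (1 - β)) {V : Set (Fin K → ℝ)}
    (hV : V ∈ frontierSpace K) (hfix : dpOperator β r V = V) :
    dpUpset β r (upset V) = upset V := by
  have h := upset_lowerFrontier (U := dpUpset β r (upset V)) (fun x hx => hx.1)
    (isClosed_dpUpset (isCompact_of_subset_cube (upset_subset V) hV.2.2.2.1))
    (dpUpset_upward _)
  rw [← lowerFrontier_dpSet hβ hr hV.2.1] at h
  rw [← h]
  exact congrArg upset hfix

/-! ### The greatest fixed upset and uniqueness of the fixed point. -/

/-- The largest set that is contained in its image under the dynamic programming operator. -/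
def greatestUpset (β : ℝ) (r : Fin m → Fin n → Fin K → ℝ) : Set (Fin K → ℝ) :=
  ⋃₀ {U | U ⊆ dpUpset β r U}

lemma subset_greatestUpset {U : Set (Fin K → ℝ)} (hU : U ⊆ dpUpset β r U) :
    U ⊆ greatestUpset β r := Set.subset_sUnion_of_mem hU

lemma greatestUpset_subset_dpUpset :
    greatestUpset β r ⊆ dpUpset β r (greatestUpset β r) :=
  Set.sUnion_subset fun _ hU => hU.trans (dpUpset_mono (subset_greatestUpset hU))

lemma dpUpset_greatestUpset : dpUpset β r (greatestUpset β r) = greatestUpset β r :=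
  (subset_greatestUpset (dpUpset_mono greatestUpset_subset_dpUpset)).antisymm
    greatestUpset_subset_dpUpset

lemma greatestUpset_subset : greatestUpset β r ⊆ Set.Icc 0 1 :=
  fun _ hx => (greatestUpset_subset_dpUpset hx).1

/-- Coinduction: the convex hull is again contained in its own image, so maximality absorbs it. The
closure is treated in the same way below. -/
lemma convex_greatestUpset : Convex ℝ (greatestUpset β r) := by
  have h : convexHull ℝ (greatestUpset β r) ⊆ greatestUpset β r :=
    subset_greatestUpset (convexHull_min
      (greatestUpset_subset_dpUpset.trans (dpUpset_mono (subset_convexHull ℝ _)))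
      (convex_dpUpset (convex_convexHull ℝ _)))
  rw [← h.antisymm (subset_convexHull ℝ _)]
  exact convex_convexHull ℝ _

lemma isClosed_greatestUpset : IsClosed (greatestUpset β r) := by
  have hsub : closure (greatestUpset β r) ⊆ Set.Icc 0 1 :=
    closure_minimal greatestUpset_subset isClosed_Icc
  have h : closure (greatestUpset β r) ⊆ greatestUpset β r :=
    subset_greatestUpset (closure_minimal
      (greatestUpset_subset_dpUpset.trans (dpUpset_mono subset_closure))
      (isClosed_dpUpset (isCompact_of_subset_cube hsub isClosed_closure)))
  exact closure_subset_iff_isClosed.1 h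

lemma greatestUpset_nonempty [NeZero m] (hβ : β ∈ Set.Ico (0 : ℝ) 1)
    (hr : ∀ a b k, r a b k ∈ Set.Icc 0 (1 - β)) : (greatestUpset β r).Nonempty := by
  -- Stage losses are at most `1 - β`, so the constant bound `1` supports itself.
  refine ⟨1, subset_greatestUpset (U := {1}) ?_ rfl⟩
  rintro _ rfl
  have h1 : (1 : Fin K → ℝ) ∈ Set.Icc (0 : Fin K → ℝ) 1 := ⟨zero_le_one, le_rfl⟩
  exact ⟨h1, stdSimplex.vertex 0, fun _ _ => 1, fun _ _ => rfl,
    fun b k => (stageBound_mem_Icc hβ hr _ (fun _ _ => h1) b k).2⟩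

/-- The contraction argument in one-sided form: raising `U` by `1` puts it above any point of `U'`
in the cube, and each application of `dpUpset` shrinks the required raise by the factor `β`.
Truncation at `1` keeps the vectors in the cube. -/
lemma min_add_pow_mem_of_subset_dpUpset (hβ : β ∈ Set.Ico (0 : ℝ) 1)
    (hr : ∀ a b k, r a b k ∈ Set.Icc 0 (1 - β))
    {U U' : Set (Fin K → ℝ)} (hne : U'.Nonempty) (hU : U ⊆ dpUpset β r U)
    (hU' : dpUpset β r U' = U') (N : ℕ) :
    ∀ u ∈ U, (fun k => min (u k + β ^ N) 1) ∈ U' := by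
  have hsub : ∀ v ∈ U', v ∈ Set.Icc (0 : Fin K → ℝ) 1 := fun v hv => by
    rw [← hU'] at hv
    exact hv.1
  have hmem : ∀ N, ∀ u ∈ U, (fun k => min (u k + β ^ N) 1) ∈ Set.Icc (0 : Fin K → ℝ) 1 :=
    fun N u hu => ⟨fun k => le_min (add_nonneg ((hU hu).1.1 k) (pow_nonneg hβ.1 _)) zero_le_one,
      fun k => min_le_right _ _⟩
  induction N with
  | zero =>
    intro u hu
    obtain ⟨v, hv⟩ := hne
    rw [← hU'] at hv ⊢
    refine dpUpset_upward _ v hv _ (hmem 0 u hu) fun k => le_min ?_ (hv.1.2 k)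
    have h1 : v k ≤ 1 := hv.1.2 k
    have h2 : 0 ≤ u k := (hU hu).1.1 k
    rw [pow_zero]; linarith
  | succ N ih =>
    intro u hu
    obtain ⟨hu1, α, R, hR, hle⟩ := hU hu
    have hQ := fun a b => ih (R a b) (hR a b)
    rw [← hU']
    refine ⟨hmem _ u hu, α, fun a b k => min (R a b k + β ^ N) 1, hQ, fun b k =>
      le_min ?_ (stageBound_mem_Icc hβ hr α (fun a b => hsub _ (hQ a b)) b k).2⟩
    calc ∑ a, α a * (r a b k + β * min (R a b k + β ^ N) 1)
        ≤ ∑ a, (α a * (r a b k + β * R a b k) + α a * β ^ (N + 1)) := by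
          refine Finset.sum_le_sum fun a _ => ?_
          rw [← mul_add]
          refine mul_le_mul_of_nonneg_left ?_ (α.2.1 a)
          have := mul_le_mul_of_nonneg_left (min_le_left (R a b k + β ^ N) 1) hβ.1
          rw [pow_succ]; linarith
      _ = ∑ a, α a * (r a b k + β * R a b k) + β ^ (N + 1) := by
          rw [Finset.sum_add_distrib, ← Finset.sum_mul, show ∑ a, α a = 1 from α.2.2, one_mul]
      _ ≤ u k + β ^ (N + 1) := by linarith [hle b k]

/-- Maximality gives one inclusion. For the other, each point of `greatestUpset` is a limit of
points of `U` as the raise `β ^ N` tends to zero. -/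
theorem eq_greatestUpset (hβ : β ∈ Set.Ico (0 : ℝ) 1)
    (hr : ∀ a b k, r a b k ∈ Set.Icc 0 (1 - β)) {U : Set (Fin K → ℝ)} (hne : U.Nonempty)
    (hc : IsClosed U) (hU : dpUpset β r U = U) : U = greatestUpset β r := by
  refine (subset_greatestUpset hU.ge).antisymm fun u hu => ?_
  have hmem := fun N => min_add_pow_mem_of_subset_dpUpset hβ hr hne greatestUpset_subset_dpUpset
    hU N u hu
  have hu1 : ∀ k, min (u k + 0) 1 = u k := fun k => by
    rw [add_zero]
    exact min_eq_left ((greatestUpset_subset hu).2 k)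
  refine hc.mem_of_tendsto (f := fun N : ℕ => fun k => min (u k + β ^ N) 1)
    (b := Filter.atTop) ?_ (Filter.Eventually.of_forall hmem)
  refine tendsto_pi_nhds.2 fun k => ?_
  have h := ((tendsto_pow_atTop_nhds_zero_of_lt_one hβ.1 hβ.2).const_add (u k)).min
    (tendsto_const_nhds (x := (1 : ℝ)))
  rwa [hu1 k] at h

theorem upset_eq_greatestUpset [NeZero n] (hβ : β ∈ Set.Ico (0 : ℝ) 1)
    (hr : ∀ a b k, r a b k ∈ Set.Icc 0 (1 - β)) {V : Set (Fin K → ℝ)}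
    (hV : V ∈ frontierSpace K) (hfix : dpOperator β r V = V) :
    upset V = greatestUpset β r :=
  eq_greatestUpset hβ hr (hV.1.mono (subset_upset hV.2.1)) hV.2.2.2.1
    (dpUpset_upset_of_fixed hβ hr hV hfix)

theorem existsUnique_fixedPoint [NeZero m] [NeZero n] (hβ : β ∈ Set.Ico (0 : ℝ) 1)
    (hr : ∀ a b k, r a b k ∈ Set.Icc 0 (1 - β)) :
    ∃! V : Set (Fin K → ℝ), V ∈ frontierSpace K ∧ dpOperator β r V = V := by
  have hup : ∀ x ∈ greatestUpset β r, ∀ y ∈ Set.Icc (0 : Fin K → ℝ) 1, x ≤ y →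
      y ∈ greatestUpset β r := by
    have := dpUpset_upward (β := β) (r := r) (greatestUpset β r)
    rwa [dpUpset_greatestUpset] at this
  have hmem := lowerFrontier_mem_frontierSpace (greatestUpset_nonempty hβ hr)
    greatestUpset_subset isClosed_greatestUpset convex_greatestUpset hup
  refine ⟨lowerFrontier (greatestUpset β r), ⟨hmem, ?_⟩, ?_⟩
  · rw [dpOperator, lowerFrontier_dpSet hβ hr hmem.2.1,
      upset_lowerFrontier greatestUpset_subset isClosed_greatestUpset hup, dpUpset_greatestUpset]
  · rintro V ⟨hV, hfix⟩
    rw [← dpUpset_greatestUpset, ← upset_eq_greatestUpset hβ hr hV hfix,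
      ← lowerFrontier_dpSet hβ hr hV.2.1]
    exact hfix.symm

/-! ### Guarantees in the repeated game -/

/-- Coinduction: the set of guarantee vectors is contained in its own image, with `πA []` as mixed
action and guarantees of the continuations of `πA` as continuation bounds. -/
theorem isGuarantee_mem_greatestUpset [NeZero n] (hβ : β ∈ Set.Ico (0 : ℝ) 1)
    (hr : ∀ a b k, r a b k ∈ Set.Icc 0 (1 - β)) {πA : Strategy m n m} {w : Fin K → ℝ}
    (hw : IsGuarantee β r πA w) : w ∈ greatestUpset β r := by
  refine subset_greatestUpset
    (U := {w | ∃ πA : Strategy m n m, IsGuarantee β r πA w}) ?_ ⟨πA, hw⟩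
  have hcube : ∀ (πA : Strategy m n m) (w : Fin K → ℝ), IsGuarantee β r πA w →
      w ∈ Set.Icc (0 : Fin K → ℝ) 1 := by
    intro πA w hw
    have h : ∀ k, w k ∈ Set.Icc (0 : ℝ) 1 := fun k => by
      obtain ⟨πB, hπB⟩ := (hw k).1
      rw [← hπB]
      exact expectedLoss_mem_Icc hβ hr πA πB k
    exact ⟨fun k => (h k).1, fun k => (h k).2⟩
  rintro w ⟨πA, hw⟩
  have h := fun a b => exists_isGuarantee hβ hr (continuation πA [((a, b) : Fin m × Fin n)])
  choose R hR using h
  refine ⟨hcube πA w hw, πA [], R, fun a b => ⟨_, hR a b⟩, fun b k => ?_⟩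
  have hbest := fun a b => (hR a b k).1
  choose best hbest using hbest
  -- Bob plays `b` and then, after each pair, maximizes component `k`. His expected loss to Alice is
  -- exactly the one-stage expression, so `w k` is at least that.
  let πB : Strategy m n n := fun h => match h with
    | [] => stdSimplex.vertex b
    | c :: h => best c.1 c.2 h
  have hcont : ∀ a b, continuation πB [((a, b) : Fin m × Fin n)] = best a b := fun a b => rfl
  have hle : expectedLoss β r πA πB k ≤ w k := (hw k).2 ⟨πB, rfl⟩
  refine le_trans (le_of_eq ?_) hle
  rw [expectedLoss_eq hβ hr, Fintype.sum_prod_type]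
  refine Finset.sum_congr rfl fun a _ => ?_
  have hv : ∀ b', πB [] b' = if b' = b then 1 else 0 := fun b' => by
    change (Pi.single b 1 : Fin n → ℝ) b' = _
    rw [Pi.single_apply]
  rw [Finset.sum_eq_single b]
  · rw [stageWeight, hv, if_pos rfl, hcont, mul_one]
    exact congrArg (fun z => πA [] a * (r a b k + β * z)) (hbest a b).symm
  · intro b' _ hb'
    rw [stageWeight, hv, if_neg hb', mul_zero, zero_mul]
  · exact fun h => absurd (Finset.mem_univ b) h

/-- The loss is bounded by the one-stage bound that results from bounds on the continuation. -/
lemma expectedLoss_le_of_continuation (hβ : β ∈ Set.Ico (0 : ℝ) 1)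
    (hr : ∀ a b k, r a b k ∈ Set.Icc 0 (1 - β)) {πA : Strategy m n m} {πB : Strategy m n n}
    {k : Fin K} {G : Fin n → ℝ} {M : ℝ}
    (hcont : ∀ c : Fin m × Fin n,
      expectedLoss β r (continuation πA [c]) (continuation πB [c]) k ≤ G c.2)
    (hM : ∀ b, ∑ a, πA [] a * r a b k + β * G b ≤ M) :
    expectedLoss β r πA πB k ≤ M := by
  rw [expectedLoss_eq hβ hr]
  calc ∑ c, stageWeight πA πB [] c *
        (r c.1 c.2 k + β * expectedLoss β r (continuation πA [c]) (continuation πB [c]) k)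
      ≤ ∑ c : Fin m × Fin n, stageWeight πA πB [] c * (r c.1 c.2 k + β * G c.2) :=
        Finset.sum_le_sum fun c _ => mul_le_mul_of_nonneg_left
          (by have := mul_le_mul_of_nonneg_left (hcont c) hβ.1; linarith)
          (stageWeight_nonneg πA πB [] c)
    _ = ∑ b, πB [] b * (∑ a, πA [] a * r a b k + β * G b) := by
        rw [Fintype.sum_prod_type_right]
        refine Finset.sum_congr rfl fun b _ => ?_
        have h1 : ∑ a, πA [] a * (β * G b) = β * G b := by
          rw [← Finset.sum_mul, show ∑ a, πA [] a = 1 from (πA []).2.2, one_mul]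
        rw [← h1, ← Finset.sum_add_distrib, Finset.mul_sum]
        refine Finset.sum_congr rfl fun a _ => ?_
        rw [stageWeight]; ring
    _ ≤ ∑ b, πB [] b * M :=
        Finset.sum_le_sum fun b _ => mul_le_mul_of_nonneg_left (hM b) ((πB []).2.1 b)
    _ = M := by rw [← Finset.sum_mul, show ∑ b, πB [] b = 1 from (πB []).2.2, one_mul]

/-! ### The parametrization of frontiers -/

lemma isCompact_paramSet : IsCompact (paramSet K) := by
  have h : paramSet K = (Set.univ.pi fun _ => Set.Icc (0 : ℝ) 1) ∩
      ⋃ k, {p : Fin K → ℝ | p k = 0} := by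
    ext p
    simp [paramSet, Pi.le_def, forall_and]
  rw [h]
  exact (isCompact_univ_pi fun _ => isCompact_Icc).inter_right
    (isClosed_iUnion_of_finite fun k => isClosed_eq (continuous_apply k) continuous_const)

/-- The least shift is the minimum of `max_k (u k - p k)`. It is taken over the compact set `upset
V`, since `V` itself is not assumed closed; a point of `V` below the minimizer does as well. -/
lemma isLeast_feasibleShifts [NeZero K] {V : Set (Fin K → ℝ)} (hV : V ∈ frontierSpace K)
    (p : Fin K → ℝ) : IsLeast (feasibleShifts p V) (sInf (feasibleShifts p V)) := by
  let g : (Fin K → ℝ) → ℝ := fun u => Finset.univ.sup' Finset.univ_nonempty fun k => u k - p k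
  have hg : Continuous g := Continuous.finset_sup'_apply _ fun k _ => by fun_prop
  obtain ⟨u, ⟨-, v, hv, hvu⟩, hmin⟩ :=
    (isCompact_of_subset_cube (upset_subset V) hV.2.2.2.1).exists_isMinOn
      (hV.1.mono (subset_upset hV.2.1)) hg.continuousOn
  have hleast : IsLeast (feasibleShifts p V) (g u) := by
    refine ⟨⟨v, hv, fun k => ?_⟩, ?_⟩
    · have h1 : u k - p k ≤ g u := Finset.le_sup' (fun k => u k - p k) (Finset.mem_univ k)
      have h2 := hvu k
      linarith
    · rintro t ⟨w, hw, hwt⟩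
      have h1 : g u ≤ g w := hmin (subset_upset hV.2.1 hw)
      exact h1.trans (Finset.sup'_le _ _ fun k _ => by linarith [hwt k])
  rwa [hleast.csInf_eq]

lemma exists_le_paramPoint [NeZero K] {V : Set (Fin K → ℝ)} (hV : V ∈ frontierSpace K)
    (p : Fin K → ℝ) : ∃ u ∈ V, u ≤ paramPoint p V :=
  (isLeast_feasibleShifts hV p).1

lemma paramPoint_eq_of_add [NeZero K] {V : Set (Fin K → ℝ)} (hV : V ∈ frontierSpace K)
    {u p : Fin K → ℝ} (hu : u ∈ V) {t : ℝ} (h : ∀ k, u k = t + p k) : paramPoint p V = u := by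
  have ht : IsLeast (feasibleShifts p V) t := by
    refine ⟨⟨u, hu, fun k => (h k).le⟩, ?_⟩
    rintro s ⟨v, hv, hvs⟩
    by_contra! hst
    have hvu : v ≤ u := fun k => by linarith [hvs k, h k]
    have := hV.2.2.1 v hv u hu hvu
    subst this
    -- A strictly smaller shift that dominates `u` itself is impossible, as coordinate `0` shows.
    linarith [hvs 0, h 0]
  funext k
  rw [paramPoint, ht.csInf_eq, h k]

/-- The parameter is `u` minus its least coordinate. For uniqueness, a zero coordinate of `p`
together with `p ≥ 0` forces the shift to be that least coordinate. -/
lemma existsUnique_paramPoint_eq [NeZero K] {V : Set (Fin K → ℝ)} (hV : V ∈ frontierSpace K)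
    {u : Fin K → ℝ} (hu : u ∈ V) :
    ∃! p : paramSet K, paramPoint (p : Fin K → ℝ) V = u := by
  obtain ⟨k₀, -, hk₀⟩ := Finset.exists_min_image Finset.univ u ⟨0, Finset.mem_univ 0⟩
  have hcube := hV.2.1 hu
  refine ⟨⟨fun k => u k - u k₀, fun k => ⟨?_, ?_⟩, k₀, sub_self _⟩, ?_, ?_⟩
  · linarith [hk₀ k (Finset.mem_univ k)]
  · have h1 : u k ≤ 1 := hcube.2 k
    have h2 : 0 ≤ u k₀ := hcube.1 k₀
    linarith
  · exact paramPoint_eq_of_add hV hu (t := u k₀) fun k => by ring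
  · rintro ⟨p, hp, j, hj⟩ hpu
    have h := fun k => congrFun hpu k
    simp only [paramPoint] at h
    ext k
    have h1 := h k₀
    have h2 := h j
    have h3 := (hp k₀).1
    have h4 := hk₀ j (Finset.mem_univ j)
    have h5 := h k
    change p k = u k - u k₀
    linarith

/-- The continuation bounds enter linearly, so `R a b` can be replaced by its mean over `a`. By
convexity the mean lies in `upset V`, and a point of `V` below it supplies the next state, which
depends on `b` but not on `a`. -/
theorem exists_stationary_data [NeZero n] [NeZero K] {V : Set (Fin K → ℝ)}
    (hV : V ∈ frontierSpace K) (hfix : dpOperator β r V = V) (hβ : 0 ≤ β) :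
    ∃ (α : paramSet K → stdSimplex ℝ (Fin m)) (q : Fin n → paramSet K → paramSet K),
      (∀ p k, stateBound β r V α q p k ≤ paramPoint (p : Fin K → ℝ) V k) ∧
      ∀ b p, paramPoint (q b p : Fin K → ℝ) V ∈ V := by
  have key : ∀ p : paramSet K, ∃ (α : stdSimplex ℝ (Fin m)) (q : Fin n → paramSet K),
      (∀ b, paramPoint (q b : Fin K → ℝ) V ∈ V) ∧
      ∀ b k, ∑ a, α a * r a b k + β * paramPoint (q b : Fin K → ℝ) V k ≤
        paramPoint (p : Fin K → ℝ) V k := by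
    intro p
    obtain ⟨u, hu, hup⟩ := exists_le_paramPoint hV (p : Fin K → ℝ)
    rw [← hfix] at hu
    obtain ⟨⟨α, R, hR, huR⟩, -⟩ := hu
    have hq : ∀ b, ∃ q : paramSet K, paramPoint (q : Fin K → ℝ) V ∈ V ∧
        ∀ k, paramPoint (q : Fin K → ℝ) V k ≤ ∑ a, α a * R a b k := by
      intro b
      have hmem : ∑ a, α a • R a b ∈ upset V :=
        hV.2.2.2.2.sum_mem (fun a _ => α.2.1 a) α.2.2
          fun a _ => subset_upset hV.2.1 (hR a b)
      obtain ⟨-, v, hv, hle⟩ := hmem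
      obtain ⟨q, hq, -⟩ := existsUnique_paramPoint_eq hV hv
      refine ⟨q, hq ▸ hv, fun k => ?_⟩
      rw [hq]
      simpa using hle k
    choose q hqV hq using hq
    refine ⟨α, q, hqV, fun b k => ?_⟩
    calc ∑ a, α a * r a b k + β * paramPoint (q b : Fin K → ℝ) V k
        ≤ ∑ a, α a * r a b k + β * ∑ a, α a * R a b k := by
          gcongr
          exact hq b k
      _ = ∑ a, α a * (r a b k + β * R a b k) := by
          rw [Finset.mul_sum, ← Finset.sum_add_distrib]
          exact Finset.sum_congr rfl fun a _ => by ring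
      _ ≤ u k := by
          rw [huR k]
          exact Finset.le_sup' (fun b : Fin n => ∑ a, α a * (r a b k + β * R a b k))
            (Finset.mem_univ b)
      _ ≤ _ := hup k
  choose α q hqV hq using key
  exact ⟨α, fun b p => q p b, fun p k => Finset.sup'_le _ _ fun b _ => hq p b k,
    fun b p => hqV p b⟩

/-! ### Stationary strategies -/

lemma continuation_stationary (α : paramSet K → stdSimplex ℝ (Fin m))
    (q : Fin n → paramSet K → paramSet K) (p : paramSet K) (h : List (Fin m × Fin n)) :
    continuation (stationary α q p) h = stationary α q (stateAfter q p h) := by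
  funext h'
  simp [continuation, stationary, stateAfter]

lemma stateAfter_eq_of_map_snd_eq (q : Fin n → paramSet K → paramSet K) (p : paramSet K)
    {h h' : List (Fin m × Fin n)} (heq : h.map Prod.snd = h'.map Prod.snd) :
    stateAfter q p h = stateAfter q p h' := by
  have key : ∀ h : List (Fin m × Fin n),
      stateAfter q p h = (h.map Prod.snd).foldl (fun s b => q b s) p := fun h => by
    rw [stateAfter, List.foldl_map]
  rw [key, key, heq]

lemma le_stateBound [NeZero n] (V : Set (Fin K → ℝ)) (α : paramSet K → stdSimplex ℝ (Fin m))
    (q : Fin n → paramSet K → paramSet K) (p : paramSet K) (k : Fin K) (b : Fin n) :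
    ∑ a, α p a * r a b k + β * paramPoint (q b p : Fin K → ℝ) V k ≤ stateBound β r V α q p k :=
  Finset.le_sup' (fun b : Fin n => ∑ a, α p a * r a b k +
    β * paramPoint (q b p : Fin K → ℝ) V k) (Finset.mem_univ b)

/-- The bound holds with slack `1` because losses lie in `[0,1]` and `paramPoint` is nonnegative;
one use of the stage inequality multiplies the slack by `β`. -/
theorem expectedLoss_stationary_le [NeZero n] [NeZero K] (hβ : β ∈ Set.Ico (0 : ℝ) 1)
    (hr : ∀ a b k, r a b k ∈ Set.Icc 0 (1 - β)) {V : Set (Fin K → ℝ)}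
    (hV : V ∈ frontierSpace K) {α : paramSet K → stdSimplex ℝ (Fin m)}
    {q : Fin n → paramSet K → paramSet K}
    (hq : ∀ p k, stateBound β r V α q p k ≤ paramPoint (p : Fin K → ℝ) V k)
    (p : paramSet K) (πB : Strategy m n n) (k : Fin K) :
    expectedLoss β r (stationary α q p) πB k ≤ paramPoint (p : Fin K → ℝ) V k := by
  have key : ∀ (N : ℕ) (p : paramSet K) (πB : Strategy m n n),
      expectedLoss β r (stationary α q p) πB k ≤ paramPoint (p : Fin K → ℝ) V k + β ^ N := by
    intro N
    induction N with
    | zero =>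
      intro p πB
      obtain ⟨u, hu, hup⟩ := exists_le_paramPoint hV (p : Fin K → ℝ)
      have h0 : 0 ≤ u k := (hV.2.1 hu).1 k
      rw [pow_zero]
      linarith [hup k, (expectedLoss_mem_Icc hβ hr (stationary α q p) πB k).2]
    | succ N ih =>
      intro p πB
      refine expectedLoss_le_of_continuation hβ hr
        (G := fun b => paramPoint (q b p : Fin K → ℝ) V k + β ^ N)
        (fun c => ih (q c.2 p) _) fun b => ?_
      have h := (le_stateBound (β := β) (r := r) V α q p k b).trans (hq p k)
      rw [pow_succ]
      change ∑ a, α p a * r a b k + _ ≤ _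
      linarith
  have hlim : Filter.Tendsto (fun N : ℕ => paramPoint (p : Fin K → ℝ) V k + β ^ N) Filter.atTop
      (nhds (paramPoint (p : Fin K → ℝ) V k)) := by
    simpa using (tendsto_pow_atTop_nhds_zero_of_lt_one hβ.1 hβ.2).const_add
      (paramPoint (p : Fin K → ℝ) V k)
  exact ge_of_tendsto' hlim fun N => key N p πB

/-- A squeeze: some `v ∈ V` lies below the guarantee `w`, which lies below the state bound, which
lies below `paramPoint p V`. Both ends are in the antichain `V`, so all four coincide. -/
theorem stationary_exact [NeZero n] [NeZero K] (hβ : β ∈ Set.Ico (0 : ℝ) 1)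
    (hr : ∀ a b k, r a b k ∈ Set.Icc 0 (1 - β)) {V : Set (Fin K → ℝ)}
    (hV : V ∈ frontierSpace K) (hfix : dpOperator β r V = V)
    {α : paramSet K → stdSimplex ℝ (Fin m)} {q : Fin n → paramSet K → paramSet K}
    (hq : ∀ p k, stateBound β r V α q p k ≤ paramPoint (p : Fin K → ℝ) V k)
    (p : paramSet K) (hp : paramPoint (p : Fin K → ℝ) V ∈ V) :
    (∀ k, paramPoint (p : Fin K → ℝ) V k = stateBound β r V α q p k) ∧
      IsGuarantee β r (stationary α q p) (paramPoint (p : Fin K → ℝ) V) := by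
  obtain ⟨w, hw⟩ := exists_isGuarantee hβ hr (stationary α q p)
  have hw1 : ∀ k, w k ≤ stateBound β r V α q p k := by
    intro k
    obtain ⟨πB, hπB⟩ := (hw k).1
    rw [← hπB]
    exact expectedLoss_le_of_continuation hβ hr
      (G := fun b => paramPoint (q b p : Fin K → ℝ) V k)
      (fun c => expectedLoss_stationary_le hβ hr hV hq (q c.2 p) _ k)
      fun b => le_stateBound V α q p k b
  have hwU := isGuarantee_mem_greatestUpset hβ hr hw
  rw [← upset_eq_greatestUpset hβ hr hV hfix] at hwU
  obtain ⟨-, v, hv, hvw⟩ := hwU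
  have hvp := hV.2.2.1 v hv _ hp fun k => (hvw k).trans ((hw1 k).trans (hq p k))
  have hpw : ∀ k, paramPoint (p : Fin K → ℝ) V k ≤ w k := hvp ▸ hvw
  have hwp : w = paramPoint (p : Fin K → ℝ) V :=
    le_antisymm (fun k => (hw1 k).trans (hq p k)) hpw
  exact ⟨fun k => le_antisymm ((hpw k).trans (hw1 k)) (hq p k), hwp ▸ hw⟩

/-- Every point of `V` is a guarantee and every guarantee dominates a point of `V`, so both sets
have the same lower frontier; that of the antichain `V` is `V`. -/
theorem fixedPoint_eq_optimalFrontier [NeZero n] [NeZero K] (hβ : β ∈ Set.Ico (0 : ℝ) 1)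
    (hr : ∀ a b k, r a b k ∈ Set.Icc 0 (1 - β)) {V : Set (Fin K → ℝ)}
    (hV : V ∈ frontierSpace K) (hfix : dpOperator β r V = V) : V = optimalFrontier β r := by
  obtain ⟨α, q, hq, -⟩ := exists_stationary_data (m := m) (r := r) hV hfix hβ.1
  have hguar : ∀ v ∈ V, ∃ πA : Strategy m n m, IsGuarantee β r πA v := by
    intro v hv
    obtain ⟨p, rfl, -⟩ := existsUnique_paramPoint_eq hV hv
    exact ⟨_, (stationary_exact hβ hr hV hfix hq p hv).2⟩
  have hdom : ∀ w ∈ {w | ∃ πA : Strategy m n m, IsGuarantee β r πA w}, ∃ v ∈ V, v ≤ w := by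
    rintro w ⟨πA, hw⟩
    have hwU := isGuarantee_mem_greatestUpset hβ hr hw
    rw [← upset_eq_greatestUpset hβ hr hV hfix] at hwU
    exact hwU.2
  have hsub : V ⊆ {w | ∃ πA : Strategy m n m, IsGuarantee β r πA w} := hguar
  rw [optimalFrontier, ← lowerFrontier_eq_of_subset hsub hdom]
  exact Set.Subset.antisymm (fun v hv => ⟨hv, fun u hu huv => hV.2.2.1 u hu v hv huv⟩)
    fun v hv => hv.1

end VectorGame

theorem theorem3 {m n K : ℕ} [NeZero m] [NeZero n] [NeZero K]
    (β : ℝ) (hβ : β ∈ Set.Ico (0 : ℝ) 1)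
    (r : Fin m → Fin n → Fin K → ℝ) (hr : ∀ a b k, r a b k ∈ Set.Icc 0 (1 - β)) :
    -- the state space is compact
    IsCompact (paramSet K) ∧
    -- the fixed point of the dynamic programming operator exists and is unique
    (∃! V : Set (Fin K → ℝ), V ∈ frontierSpace K ∧ dpOperator β r V = V) ∧
    ∀ V ∈ frontierSpace K, dpOperator β r V = V →
      -- it is the set of optimal guarantees of the infinitely repeated game
      V = optimalFrontier β r ∧
      -- it is parametrized by the state space
      (∀ p : paramSet K, IsLeast (feasibleShifts (p : Fin K → ℝ) V)
        (sInf (feasibleShifts (p : Fin K → ℝ) V))) ∧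
      (∀ u ∈ V, ∃! p : paramSet K, paramPoint (p : Fin K → ℝ) V = u) ∧
      -- mixed actions and transitions as required exist
      (∃ (α : paramSet K → stdSimplex ℝ (Fin m)) (q : Fin n → paramSet K → paramSet K),
        (∀ p k, stateBound β r V α q p k ≤ paramPoint (p : Fin K → ℝ) V k) ∧
        ∀ b p, paramPoint (q b p : Fin K → ℝ) V ∈ V) ∧
      -- and all of them yield stationary strategies with the bounds claimed
      ∀ (α : paramSet K → stdSimplex ℝ (Fin m)) (q : Fin n → paramSet K → paramSet K),
        (∀ p k, stateBound β r V α q p k ≤ paramPoint (p : Fin K → ℝ) V k) →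
        ∀ p₁ : paramSet K,
          -- the loss never exceeds the bound of the initial state
          (∀ (πB : Strategy m n n) (k : Fin K),
            expectedLoss β r (stationary α q p₁) πB k ≤ paramPoint (p₁ : Fin K → ℝ) V k) ∧
          -- after every history, what follows is bounded by the bound of the current state
          (∀ (h : List (Fin m × Fin n)) (πB : Strategy m n n) (k : Fin K),
            expectedLoss β r (continuation (stationary α q p₁) h) πB k ≤
              paramPoint (stateAfter q p₁ h : Fin K → ℝ) V k) ∧
          -- on the frontier the bounds are exact
          (paramPoint (p₁ : Fin K → ℝ) V ∈ V →
            (∀ k, paramPoint (p₁ : Fin K → ℝ) V k = stateBound β r V α q p₁ k) ∧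
            IsGuarantee β r (stationary α q p₁) (paramPoint (p₁ : Fin K → ℝ) V)) ∧
          -- Alice's own past actions are ignored
          (∀ h h' : List (Fin m × Fin n), h.map Prod.snd = h'.map Prod.snd →
            stationary α q p₁ h = stationary α q p₁ h') := by
  refine ⟨isCompact_paramSet, existsUnique_fixedPoint hβ hr, fun V hV hfix =>
    ⟨fixedPoint_eq_optimalFrontier hβ hr hV hfix, fun p => isLeast_feasibleShifts hV p,
      fun u hu => existsUnique_paramPoint_eq hV hu, exists_stationary_data hV hfix hβ.1,
      fun α q hq p₁ => ⟨expectedLoss_stationary_le hβ hr hV hq p₁, fun h πB k => ?_,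
        stationary_exact hβ hr hV hfix hq p₁, fun h h' heq =>
          congrArg α (stateAfter_eq_of_map_snd_eq q p₁ heq)⟩⟩⟩
  rw [continuation_stationary]
  exact expectedLoss_stationary_le hβ hr hV hq _ πB k
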